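/- Let $K$ be a number field with ring of integers $\mathfrak o_K$, and let $R\subseteq K$ be a subring whose field of fractions is $K$. Let $T$ be the set of nonzero prime ideals $\mathfrak p$ of $\mathfrak o_K$ for which there is an $x\in R$ with $\mathrm{ord}_{\mathfrak p}(x)<0$, and assume that $T$ is finite. Put $\mathfrak o=R\cap\mathfrak o_K$. For a domain $A$ let $\mathrm{Pic}(A)$ denote the group of invertible fractional ideals of $A$ modulo the principal ones, and let $\prod_{\mathfrak p\in T}\mathfrak p^{\mathbb Z}$ denote the group of fractional $\mathfrak o_K$-ideals generated by the primes in $T$. Then for every $\mathfrak p\in T$ the ideal $\mathfrak p\cap\mathfrak o$ of $\mathfrak o$ is invertible, there is a group homomorphism $\prod_{\mathfrak p\in T}\mathfrak p^{\mathbb Z}\to\mathrm{Pic}(\mathfrak o)$ sending each $\mathfrak p\in T$ to the class of its contraction $\mathfrak p\cap\mathfrak o$, and with this map the sequence $$\prod_{\mathfrak p\in T}\mathfrak p^{\mathbb Z}\longrightarrow\mathrm{Pic}(\mathfrak o)\stackrel{\Phi}{\longrightarrow}\mathrm{Pic}(R)\longrightarrow 1$$ is exact, where $\Phi$ is induced by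 extension of ideals, $\mathfrak a\mapsto\mathfrak aR$. -/

import Mathlib

open scoped nonZeroDivisors NumberField
open IsDedekindDomain

namespace NumberRing

noncomputable section

variable {K : Type*} [Field K]

/-- The ring `𝔬 = R ∩ 𝓞 K` of algebraic integers in a subring `R` of the number field `K`. -/
def order (R : Subring K) : Subring K := R ⊓ (integralClosure ℤ K).toSubring

/-- The inclusion `𝔬 → R`. -/
instance (R : Subring K) : Algebra (order R) R :=
  (Subring.inclusion (inf_le_left : order R ≤ R)).toAlgebra

theorem coe_algebraMap_order (R : Subring K) (x : order R) :
    ((algebraMap (order R) R x : R) : K) = x := rfl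

instance (R : Subring K) : Module.IsTorsionFree (order R) R :=
  Module.isTorsionFree_iff_algebraMap_injective.mpr
    (Subring.inclusion_injective (inf_le_left : order R ≤ R))

/-- If the field of fractions of `R` is `K`, then so is the field of fractions of `𝔬`. -/
instance [NumberField K] (R : Subring K) [IsFractionRing R K] : IsFractionRing (order R) K := by
  refine IsFractionRing.of_field (order R) K fun z => ?_
  obtain ⟨a, b, hb, rfl⟩ := IsFractionRing.div_surjective (A := R) z
  have alg : ∀ x : K, IsAlgebraic ℤ x := fun x =>
    (IsFractionRing.isAlgebraic_iff ℤ ℚ K).mpr (Algebra.IsAlgebraic.isAlgebraic x)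
  obtain ⟨m, hm, hma⟩ := (alg (a : K)).exists_integral_multiple
  obtain ⟨n, hn, hnb⟩ := (alg (b : K)).exists_integral_multiple
  have key : ∀ x : R, ∀ k l : ℤ, IsIntegral ℤ (k • (x : K)) → ((l * k) • (x : K)) ∈ order R :=
    fun x k l h => ⟨R.zsmul_mem x.2 _, by
      change IsIntegral ℤ _
      rw [mul_smul]
      exact h.smul l⟩
  refine ⟨⟨_, key a m n hma⟩, ⟨_, key b n m hnb⟩, ?_⟩
  change (a : K) / (b : K) = ((n * m) • (a : K)) / ((m * n) • (b : K))
  have h : (((n * m : ℤ)) : K) ≠ 0 := by exact_mod_cast mul_ne_zero hn hm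
  rw [mul_comm m n, zsmul_eq_mul, zsmul_eq_mul, mul_div_mul_left _ _ h]

/-- The inclusion `𝔬 → 𝓞 K`. -/
def orderToRingOfIntegers (R : Subring K) : order R →+* 𝓞 K :=
  (order R).subtype.codRestrict (integralClosure ℤ K) fun x => x.2.2

theorem coe_orderToRingOfIntegers (R : Subring K) (x : order R) :
    ((orderToRingOfIntegers R x : 𝓞 K) : K) = x := rfl

variable [NumberField K]

/-- The contraction `𝔭 ∩ 𝔬` of a prime `𝔭` of `𝓞 K`. -/
def contraction (R : Subring K) (p : HeightOneSpectrum (𝓞 K)) : Ideal (order R) :=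
  p.asIdeal.comap (orderToRingOfIntegers R)

/-- The set `T` of (nonzero) primes `𝔭` of `𝓞 K` such that `ord_𝔭 x < 0` for some `x ∈ R`.
(In terms of the multiplicative valuation, `ord_𝔭 x < 0` reads `1 < |x|_𝔭`.) -/
def polePrimes (R : Subring K) : Set (HeightOneSpectrum (𝓞 K)) :=
  {p | ∃ x ∈ R, 1 < p.valuation K x}

/-- A nonzero prime of `𝓞 K` as an element of the group of fractional ideals of `𝓞 K`. -/
def primeUnit (p : HeightOneSpectrum (𝓞 K)) : (FractionalIdeal (𝓞 K)⁰ K)ˣ :=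
  Units.mk0 (p.asIdeal : FractionalIdeal (𝓞 K)⁰ K)
    (FractionalIdeal.coeIdeal_ne_zero.mpr p.ne_bot)

/-- The group `∏_{𝔭 ∈ T} 𝔭^ℤ` of fractional ideals of `𝓞 K` generated by the primes in `T`. -/
def poleGroup (R : Subring K) : Subgroup (FractionalIdeal (𝓞 K)⁰ K)ˣ :=
  Subgroup.closure (primeUnit '' polePrimes R)

/-- A prime in `T` as an element of `∏_{𝔭 ∈ T} 𝔭^ℤ`. -/
def polePrime (R : Subring K) (p : polePrimes R) : poleGroup R :=
  ⟨primeUnit p.1, Subgroup.subset_closure ⟨p.1, p.2, rfl⟩⟩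

end

end NumberRing

/-! The point is that `R` is the localization of `𝔬` at `S = inverted R`, and that an ideal of `𝔬`
meeting `S` is coprime to a conductor, hence invertible. Let `𝔣 ≠ 0` be the conductor of `R` in `R·𝓞
K`. Finiteness of the class group writes any `x ∈ R` as `c/t` with `c, t ∈ 𝓞 K` and `t⁻¹ ∈ R·𝓞 K`
(`exists_denominator`). Such a `t` is a non-zero-divisor in the finite ring `𝓞 K/𝔣`, so some power
is `1` mod `𝔣`. That power lies in `S` (`exists_pow_mem_inverted`), so `S` clears the denominator of
`x`. Consequently a prime of `𝓞 K` is in `T` iff its contraction meets `S`, and these contractions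
are invertible and become trivial in `R`. Surjectivity: finitely many elements witnessing that an
ideal of `R` is invertible already generate an invertible ideal over `𝔬`. Kernel: a class that dies
in `Pic(R)` is represented by an ideal meeting `S`, and Noetherian induction factors it into
contractions of primes in `T`. -/

namespace NumberRing

/-! ### The conductor, and `R` as a localization of `𝔬` -/

variable {K : Type*} [Field K]

/-- The compositum `R · 𝓞 K` inside `K`. -/
def compositum (R : Subring K) : Subalgebra R K :=
  Algebra.adjoin R (integralClosure ℤ K : Set K)

theorem coe_mem_compositum (R : Subring K) (a : 𝓞 K) : algebraMap (𝓞 K) K a ∈ compositum R :=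
  Algebra.subset_adjoin a.2

theorem mem_compositum_of_mem {R : Subring K} {x : K} (hx : x ∈ R) : x ∈ compositum R :=
  (compositum R).algebraMap_mem ⟨x, hx⟩

theorem compositum_toSubmodule (R : Subring K) :
    Subalgebra.toSubmodule (compositum R) = Submodule.span R (integralClosure ℤ K : Set K) := by
  rw [compositum, Algebra.adjoin_eq_span]
  congr 1
  exact congrArg SetLike.coe
    (Submonoid.closure_eq (integralClosure ℤ K).toSubsemiring.toSubmonoid)

/-- The conductor of `R` in `R · 𝓞 K`, as an ideal of `𝓞 K`. -/
def conductor (R : Subring K) : Ideal (𝓞 K) where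
  carrier := {a | ∀ y ∈ compositum R, algebraMap (𝓞 K) K a * y ∈ R}
  zero_mem' y _ := by simp
  add_mem' {a b} ha hb y hy := by
    rw [map_add, add_mul]
    exact R.add_mem (ha y hy) (hb y hy)
  smul_mem' c a ha y hy := by
    rw [smul_eq_mul, map_mul, mul_comm (algebraMap (𝓞 K) K c), mul_assoc]
    exact ha _ (mul_mem (coe_mem_compositum R c) hy)

theorem coe_mem_order_iff {R : Subring K} {a : 𝓞 K} :
    algebraMap (𝓞 K) K a ∈ order R ↔ algebraMap (𝓞 K) K a ∈ R :=
  ⟨fun h => h.1, fun h => ⟨h, a.2⟩⟩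

theorem coe_mem_order_of_mem_conductor {R : Subring K} {a : 𝓞 K} (ha : a ∈ conductor R) :
    algebraMap (𝓞 K) K a ∈ order R :=
  coe_mem_order_iff.2 (by simpa using ha 1 (one_mem _))

/-- The conductor is stable under multiplication by `R·𝓞 K`, so `t` acts on `𝓞 K/𝔣` without zero
divisors. -/
theorem mem_conductor_of_mul_mem {R : Subring K} {a t : 𝓞 K} (ht : t ≠ 0)
    (hti : (algebraMap (𝓞 K) K t)⁻¹ ∈ compositum R)
    (h : a * t ∈ conductor R) : a ∈ conductor R := by
  intro y hy
  have ht' : algebraMap (𝓞 K) K t ≠ 0 := by simpa using ht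
  have := h _ (mul_mem hti hy)
  rwa [map_mul, mul_assoc, mul_inv_cancel_left₀ ht'] at this

theorem algebraMap_orderToRingOfIntegers (R : Subring K) (x : order R) :
    algebraMap (𝓞 K) K (orderToRingOfIntegers R x) = x := rfl

variable [NumberField K]

/-- A common denominator in `𝔬` for a finite set of `ℤ`-generators of `𝓞 K` lies in the conductor,
because `𝓞 K` spans `R·𝓞 K` over `R`. -/
theorem conductor_ne_bot (R : Subring K) [IsFractionRing R K] : conductor R ≠ ⊥ := by
  obtain ⟨s, hs⟩ := (Module.Finite.fg_top : (⊤ : Submodule ℤ (𝓞 K)).FG)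
  obtain ⟨b, hb⟩ := IsLocalization.exist_integer_multiples (order R)⁰ s
    (algebraMap (𝓞 K) K)
  have hmul : ∀ a : 𝓞 K, ((b : order R) : K) * algebraMap (𝓞 K) K a ∈ R := by
    intro a
    have ha : a ∈ Submodule.span ℤ (s : Set (𝓞 K)) := hs ▸ Submodule.mem_top
    induction ha using Submodule.span_induction with
    | mem x hx =>
      obtain ⟨z, hz⟩ := hb x hx
      have : ((b : order R) : K) * algebraMap (𝓞 K) K x = (z : K) := hz.symm
      rw [this]
      exact z.2.1
    | zero => simp
    | add x y _ _ hx hy => rw [map_add, mul_add]; exact R.add_mem hx hy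
    | smul n x _ hx =>
      rw [map_zsmul, mul_smul_comm]
      exact R.zsmul_mem hx n
  have hmem : orderToRingOfIntegers R b ∈ conductor R := by
    intro y hy
    rw [← Subalgebra.mem_toSubmodule, compositum_toSubmodule] at hy
    rw [algebraMap_orderToRingOfIntegers]
    induction hy using Submodule.span_induction with
    | mem x hx => exact hmul ⟨x, hx⟩
    | zero => simp
    | add x y _ _ hx hy => rw [mul_add]; exact R.add_mem hx hy
    | smul r x _ hx => rw [mul_smul_comm]; exact R.mul_mem r.2 hx
  intro h
  rw [h, Ideal.mem_bot] at hmem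
  have h0 : ((b : order R) : K) = 0 := by
    rw [← algebraMap_orderToRingOfIntegers, hmem, map_zero]
  exact nonZeroDivisors.coe_ne_zero b (Subtype.ext h0)

-- Dividing the generators of `(a, b)` by `b` gives `a/b ∈ R` and `1`.
omit [NumberField K] in
theorem div_pow_mem_compositum {R : Subring K} {a b : 𝓞 K} (hb : b ≠ 0)
    (hx : algebraMap (𝓞 K) K a / algebraMap (𝓞 K) K b ∈ R)
    (n : ℕ) {y : 𝓞 K} (hy : y ∈ Ideal.span {a, b} ^ n) :
    algebraMap (𝓞 K) K y / algebraMap (𝓞 K) K b ^ n ∈ compositum R := by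
  have hb' : algebraMap (𝓞 K) K b ≠ 0 := by simpa using hb
  induction n generalizing y with
  | zero => simpa using coe_mem_compositum R y
  | succ n ih =>
    rw [pow_succ] at hy
    induction hy using Submodule.mul_induction_on' with
    | mem_mul_mem u hu v hv =>
      obtain ⟨r, s, rfl⟩ := Ideal.mem_span_pair.1 hv
      have : algebraMap (𝓞 K) K (u * (r * a + s * b)) / algebraMap (𝓞 K) K b ^ (n + 1) =
          algebraMap (𝓞 K) K u / algebraMap (𝓞 K) K b ^ n *
            (algebraMap (𝓞 K) K r * (algebraMap (𝓞 K) K a / algebraMap (𝓞 K) K b) +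
              algebraMap (𝓞 K) K s) := by
        simp only [map_mul, map_add]
        field_simp
        ring
      rw [this]
      exact mul_mem (ih hu) (add_mem (mul_mem (coe_mem_compositum R r)
        (mem_compositum_of_mem hx)) (coe_mem_compositum R s))
    | add u _ v _ hu hv =>
      rw [map_add, add_div]
      exact add_mem hu hv

/-- For `x = a/b`, a power `(a, b)^(n+1)` is principal, say `(g)`. Removing the factor `g` from
`b^n·a / b^(n+1)` leaves `c/t`, and `t⁻¹ = g/b^(n+1)`. -/
theorem exists_denominator {R : Subring K} {x : K} (hx : x ∈ R) :
    ∃ t c : 𝓞 K, t ≠ 0 ∧ algebraMap (𝓞 K) K t * x = algebraMap (𝓞 K) K c ∧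
      (algebraMap (𝓞 K) K t)⁻¹ ∈ compositum R := by
  obtain ⟨a, b, hb, rfl⟩ := IsFractionRing.div_surjective (A := 𝓞 K) x
  have hb0 : b ≠ 0 := nonZeroDivisors.ne_zero hb
  have hb' : algebraMap (𝓞 K) K b ≠ 0 := by simpa using hb0
  have hI : Ideal.span {a, b} ∈ (Ideal (𝓞 K))⁰ := by
    rw [mem_nonZeroDivisors_iff_ne_zero]
    intro h
    exact hb0 (Ideal.mem_bot.1 (by rw [← Ideal.zero_eq_bot, ← h]; exact Ideal.subset_span (by simp)))
  -- The exponent `n + 1` is the class number; the successor form makes `b^n·a` available.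
  obtain ⟨n, hn⟩ : ∃ n, Fintype.card (ClassGroup (𝓞 K)) = n + 1 :=
    Nat.exists_eq_succ_of_ne_zero Fintype.card_ne_zero
  have hp : (Ideal.span {a, b} ^ (n + 1)).IsPrincipal := by
    rw [← ClassGroup.mk0_eq_one_iff (pow_mem hI (n + 1))]
    have := pow_card_eq_one (x := ClassGroup.mk0 ⟨_, hI⟩)
    rw [hn, ← map_pow] at this
    exact this
  obtain ⟨g, hg⟩ := hp.principal
  have hbI : b ∈ Ideal.span {a, b} := Ideal.subset_span (by simp)
  have haI : a ∈ Ideal.span {a, b} := Ideal.subset_span (by simp)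
  have h1 : b ^ (n + 1) ∈ Ideal.span {g} := by
    rw [← Ideal.submodule_span_eq, ← hg]; exact Ideal.pow_mem_pow hbI _
  have h2 : b ^ n * a ∈ Ideal.span {g} := by
    rw [← Ideal.submodule_span_eq, ← hg, pow_succ]
    exact Ideal.mul_mem_mul (Ideal.pow_mem_pow hbI _) haI
  have h3 : g ∈ Ideal.span {a, b} ^ (n + 1) := by
    rw [hg]; exact Submodule.mem_span_singleton_self g
  obtain ⟨t, ht⟩ := Ideal.mem_span_singleton.1 h1
  obtain ⟨c, hc⟩ := Ideal.mem_span_singleton.1 h2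
  have hgt : g * t ≠ 0 := ht ▸ pow_ne_zero _ hb0
  have hg0 : algebraMap (𝓞 K) K g ≠ 0 := by simpa using left_ne_zero_of_mul hgt
  have ht' : algebraMap (𝓞 K) K b ^ (n + 1) = algebraMap (𝓞 K) K g * algebraMap (𝓞 K) K t := by
    rw [← map_pow, ht, map_mul]
  have hc' : algebraMap (𝓞 K) K b ^ n * algebraMap (𝓞 K) K a =
      algebraMap (𝓞 K) K g * algebraMap (𝓞 K) K c := by
    rw [← map_pow, ← map_mul, hc, map_mul]
  refine ⟨t, c, right_ne_zero_of_mul hgt, ?_, ?_⟩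
  · apply mul_left_cancel₀ hg0
    rw [← hc', ← mul_assoc, ← ht']
    field_simp
    ring
  · have := div_pow_mem_compositum hb0 hx (n + 1) h3
    rwa [ht', div_mul_cancel_left₀ hg0] at this

/-- Pigeonhole in the finite ring `𝓞 K/𝔣`, followed by cancellation of powers of `t`. -/
theorem exists_pow_sub_one_mem_conductor {R : Subring K} [IsFractionRing R K] {t : 𝓞 K}
    (ht : t ≠ 0) (hti : (algebraMap (𝓞 K) K t)⁻¹ ∈ compositum R) :
    ∃ n ≠ 0, t ^ n - 1 ∈ conductor R := by
  have : Finite (𝓞 K ⧸ conductor R) := Ideal.finiteQuotientOfFreeOfNeBot _ (conductor_ne_bot R)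
  have hreg : ∀ n (a : 𝓞 K), a * t ^ n ∈ conductor R → a ∈ conductor R := by
    intro n
    induction n with
    | zero => intro a h; simpa using h
    | succ n ih =>
      intro a h
      rw [pow_succ, ← mul_assoc] at h
      exact ih a (mem_conductor_of_mul_mem ht hti h)
  obtain ⟨i, j, hij, h⟩ := Finite.exists_ne_map_eq_of_infinite
    (fun n : ℕ => Ideal.Quotient.mk (conductor R) (t ^ n))
  wlog hlt : i < j generalizing i j
  · exact this j i hij.symm h.symm (lt_of_le_of_ne (not_lt.1 hlt) hij.symm)
  refine ⟨j - i, (Nat.sub_pos_of_lt hlt).ne', hreg i _ ?_⟩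
  rw [sub_mul, one_mul, ← pow_add, Nat.sub_add_cancel hlt.le]
  exact Ideal.Quotient.eq.1 h.symm

/-- The elements of `𝔬` that become units in `R`. -/
def inverted (R : Subring K) : Submonoid (order R) :=
  (IsUnit.submonoid R).comap (algebraMap (order R) R)

omit [NumberField K] in
theorem mem_inverted_iff {R : Subring K} {t : order R} :
    t ∈ inverted R ↔ (t : K) ≠ 0 ∧ (t : K)⁻¹ ∈ R := by
  change IsUnit (algebraMap (order R) R t) ↔ _
  rw [isUnit_iff_exists_inv]
  constructor
  · rintro ⟨b, hb⟩
    have hb' : (t : K) * b = 1 := congrArg Subtype.val hb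
    exact ⟨left_ne_zero_of_mul_eq_one hb', by rw [← eq_inv_of_mul_eq_one_right hb']; exact b.2⟩
  · rintro ⟨h0, h⟩
    exact ⟨⟨_, h⟩, Subtype.ext (mul_inv_cancel₀ h0)⟩

theorem exists_pow_mem_inverted {R : Subring K} [IsFractionRing R K] {t : 𝓞 K}
    (ht : t ≠ 0) (hti : (algebraMap (𝓞 K) K t)⁻¹ ∈ compositum R) :
    ∃ n ≠ 0, ∃ s ∈ inverted R, orderToRingOfIntegers R s = t ^ n ∧ t ^ n - 1 ∈ conductor R := by
  obtain ⟨n, hn, h⟩ := exists_pow_sub_one_mem_conductor ht hti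
  have ht' : algebraMap (𝓞 K) K t ≠ 0 := by simpa using ht
  have hmem : algebraMap (𝓞 K) K (t ^ n) ∈ order R := by
    have := (order R).add_mem (coe_mem_order_of_mem_conductor h) (order R).one_mem
    simpa using this
  refine ⟨n, hn, ⟨_, hmem⟩, mem_inverted_iff.2 ⟨by simpa using pow_ne_zero n ht', ?_⟩, rfl, h⟩
  have h1 := R.sub_mem R.one_mem (h _ (pow_mem hti n))
  -- This identity puts `t⁻ⁿ` in `R`: the subtracted product is a conductor element times an element
  -- of `R·𝓞 K`.
  have h2 : (1 : K) - algebraMap (𝓞 K) K (t ^ n - 1) * (algebraMap (𝓞 K) K t)⁻¹ ^ n =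
      (algebraMap (𝓞 K) K (t ^ n))⁻¹ := by
    rw [map_sub, map_pow, map_one, sub_mul, inv_pow, mul_inv_cancel₀ (pow_ne_zero n ht'),
      sub_sub_cancel, one_mul]
  rwa [h2] at h1

theorem exists_inverted_mul_eq {R : Subring K} [IsFractionRing R K] {x : K} (hx : x ∈ R) :
    ∃ s ∈ inverted R, ∃ y : order R, (s : K) * x = y := by
  obtain ⟨t, c, ht, hc, hti⟩ := exists_denominator hx
  obtain ⟨n, hn, s, hs, hst, -⟩ := exists_pow_mem_inverted ht hti
  obtain ⟨m, rfl⟩ := Nat.exists_eq_succ_of_ne_zero hn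
  have hsK : (s : K) = algebraMap (𝓞 K) K t ^ (m + 1) := by
    rw [← algebraMap_orderToRingOfIntegers, hst, map_pow]
  have hsx : (s : K) * x = algebraMap (𝓞 K) K (t ^ m * c) := by
    rw [hsK, map_mul, ← hc, map_pow]; ring
  exact ⟨s, hs, ⟨_, R.mul_mem s.2.1 hx, hsx ▸ (t ^ m * c).2⟩, rfl⟩

/-! ### Ideals of `𝔬` meeting `S`, and the primes in `T` -/

theorem exists_conductor_add_eq_one {R : Subring K} [IsFractionRing R K] {I : Ideal (order R)}
    {s : order R} (hs : s ∈ inverted R) (hsI : s ∈ I) :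
    ∃ a ∈ I, ∃ b ∈ conductor R, orderToRingOfIntegers R a + b = 1 := by
  have h := mem_inverted_iff.1 hs
  have h0 : orderToRingOfIntegers R s ≠ 0 := fun h0 =>
    h.1 (by rw [← algebraMap_orderToRingOfIntegers, h0, map_zero])
  obtain ⟨n, hn, hmem⟩ := exists_pow_sub_one_mem_conductor (R := R) h0
    (by rw [algebraMap_orderToRingOfIntegers]; exact mem_compositum_of_mem h.2)
  exact ⟨s ^ n, I.pow_mem_of_mem hsI n (Nat.pos_of_ne_zero hn), _, neg_mem hmem, by
    rw [map_pow]; ring⟩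

/-- If `x = c/t` has a pole at `𝔭`, then `𝔭` must contain `t`, hence also the power of `t` lying in
`S`. -/
theorem exists_mem_inverted_mem_contraction {R : Subring K} [IsFractionRing R K]
    {p : HeightOneSpectrum (𝓞 K)} (hp : p ∈ polePrimes R) :
    ∃ s ∈ inverted R, s ∈ contraction R p := by
  obtain ⟨x, hx, hlt⟩ := hp
  obtain ⟨t, c, ht, hc, hti⟩ := exists_denominator hx
  obtain ⟨n, hn, s, hs, hst, -⟩ := exists_pow_mem_inverted ht hti
  refine ⟨s, hs, ?_⟩
  rw [contraction, Ideal.mem_comap, hst]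
  refine Ideal.pow_mem_of_mem _ ?_ n (Nat.pos_of_ne_zero hn)
  by_contra htp
  have h1 : p.valuation K (algebraMap (𝓞 K) K t) = 1 := by
    rw [HeightOneSpectrum.valuation_of_algebraMap]
    exact HeightOneSpectrum.intValuation_eq_one_iff.2 htp
  have h2 := congrArg (p.valuation K) hc
  rw [map_mul, h1, one_mul] at h2
  exact absurd (h2 ▸ p.valuation_le_one c) (not_le.2 hlt)

theorem mem_polePrimes_of_mem_contraction {R : Subring K} {p : HeightOneSpectrum (𝓞 K)}
    {s : order R} (hs : s ∈ inverted R) (hsp : s ∈ contraction R p) : p ∈ polePrimes R := by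
  obtain ⟨h0, h⟩ := mem_inverted_iff.1 hs
  refine ⟨_, h, ?_⟩
  rw [map_inv₀, one_lt_inv₀ ((p.valuation K).pos_iff.2 h0), ← algebraMap_orderToRingOfIntegers]
  exact (p.valuation_lt_one_iff_mem _).2 hsp

end NumberRing

/-! ### Extension of ideal classes, computed in arbitrary fraction fields -/

section ClassGroup

open FractionalIdeal

theorem FractionalIdeal.canonicalEquiv_eq_extended {A : Type*} [CommRing A] (K K' : Type*)
    [CommRing K] [CommRing K'] [Algebra A K] [IsFractionRing A K] [Algebra A K']
    [IsFractionRing A K'] (h : A⁰ ≤ Submonoid.comap (RingHom.id A) A⁰)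
    (I : FractionalIdeal A⁰ K) : canonicalEquiv A⁰ K K' I = I.extended K' h := by
  rw [← coeToSubmodule_inj, coe_extended_eq_span,
    ← Submodule.span_eq (canonicalEquiv A⁰ K K' I : Submodule A K')]
  congr 1
  ext x
  exact mem_canonicalEquiv_apply _ _ _

theorem FractionalIdeal.extendedHom_canonicalEquiv {A B : Type*} [CommRing A] [IsDomain A]
    [CommRing B] [IsDomain B] [Algebra A B] [Module.IsTorsionFree A B]
    (K K' L L' : Type*) [Field K] [Field K'] [Field L] [Field L']
    [Algebra A K] [IsFractionRing A K] [Algebra A K'] [IsFractionRing A K']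
    [Algebra B L] [IsFractionRing B L] [Algebra B L'] [IsFractionRing B L']
    (I : FractionalIdeal A⁰ K) :
    extendedHom L' B (canonicalEquiv A⁰ K K' I) =
      canonicalEquiv B⁰ L L' (extendedHom L B I) := by
  have hA : A⁰ ≤ Submonoid.comap (RingHom.id A) A⁰ := fun _ h => h
  have hB : B⁰ ≤ Submonoid.comap (RingHom.id B) B⁰ := fun _ h => h
  rw [canonicalEquiv_eq_extended K K' hA, canonicalEquiv_eq_extended L L' hB,
    extendedHom'_apply, extendedHom'_apply,
    extended_extended, extended_extended]

theorem ClassGroup.extendedHom_mk_of_isFractionRing (A B K L : Type*) [CommRing A] [IsDomain A]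
    [CommRing B] [IsDomain B] [Algebra A B] [Module.IsTorsionFree A B] [Field K] [Field L]
    [Algebra A K] [IsFractionRing A K] [Algebra B L] [IsFractionRing B L]
    (I : (FractionalIdeal A⁰ K)ˣ) :
    ClassGroup.extendedHom A B (ClassGroup.mk K I) =
      ClassGroup.mk L (Units.map (FractionalIdeal.extendedHom L B).toMonoidHom I) := by
  rw [← ClassGroup.mk_canonicalEquiv K (FractionRing A), ClassGroup.extendedHom_mk,
    ← ClassGroup.mk_canonicalEquiv L (FractionRing B)]
  congr 1
  ext1
  exact extendedHom_canonicalEquiv ..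

end ClassGroup

/-! ### Invertibility and clearing denominators -/

namespace NumberRing

variable {K : Type*} [Field K] [NumberField K]

instance (R : Subring K) : IsNoetherianRing (order R) := by
  have : IsNoetherian ℤ (order R) :=
    isNoetherian_of_injective (orderToRingOfIntegers R).toAddMonoidHom.toIntLinearMap
      fun x y h => Subtype.ext (congrArg (algebraMap (𝓞 K) K) h)
  exact isNoetherian_of_tower ℤ this

/-- Write `1 = a + b` with `a ∈ I`, `b ∈ 𝔣`. Clearly `a ∈ I·I⁻¹`. The extension `E = I·𝓞 K` is
invertible, and `b` carries `E·E⁻¹ = 𝓞 K` into `I·I⁻¹`. -/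
theorem isUnit_coeIdeal_of_mem_inverted {R : Subring K} [IsFractionRing R K] {I : Ideal (order R)}
    {s : order R} (hs : s ∈ inverted R) (hsI : s ∈ I) :
    IsUnit (I : FractionalIdeal (order R)⁰ K) := by
  have hs0 : s ≠ 0 := fun h => (mem_inverted_iff.1 hs).1 (by rw [h]; rfl)
  have hI0 : (I : FractionalIdeal (order R)⁰ K) ≠ 0 :=
    FractionalIdeal.coeIdeal_ne_zero.2 fun h => hs0 (Ideal.mem_bot.1 (h ▸ hsI))
  obtain ⟨a, ha, b, hb, hab⟩ := exists_conductor_add_eq_one hs hsI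
  rw [← FractionalIdeal.mul_inv_cancel_iff_isUnit]
  refine le_antisymm (FractionalIdeal.mul_one_div_le_one) ?_
  rw [FractionalIdeal.one_le]
  set E : Ideal (𝓞 K) := I.map (orderToRingOfIntegers R)
  have hE0 : (E : FractionalIdeal (𝓞 K)⁰ K) ≠ 0 := by
    refine FractionalIdeal.coeIdeal_ne_zero.2 fun h => (mem_inverted_iff.1 hs).1 ?_
    have : orderToRingOfIntegers R s ∈ E := Ideal.mem_map_of_mem _ hsI
    rw [h, Ideal.mem_bot] at this
    rw [← algebraMap_orderToRingOfIntegers, this, map_zero]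
  have key : ∀ α ∈ E, ∀ β ∈ (E : FractionalIdeal (𝓞 K)⁰ K)⁻¹,
      algebraMap (𝓞 K) K α * β * algebraMap (𝓞 K) K b ∈
        (I : FractionalIdeal (order R)⁰ K) * (I : FractionalIdeal (order R)⁰ K)⁻¹ := by
    intro α hα
    induction hα using Submodule.span_induction with
    | mem x hx =>
      obtain ⟨y, hy, rfl⟩ := hx
      intro β hβ
      rw [mul_assoc]
      -- Here `β·b ∈ I⁻¹`: `β` maps `I` into `𝓞 K`, and `b` maps `𝓞 K` into `𝔬`.
      refine FractionalIdeal.mul_mem_mul (FractionalIdeal.mem_coeIdeal_of_mem _ hy) ?_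
      rw [FractionalIdeal.mem_inv_iff hI0]
      intro z hz
      obtain ⟨z, hz', rfl⟩ := (FractionalIdeal.mem_coeIdeal _).1 hz
      have h1 := (FractionalIdeal.mem_inv_iff hE0).1 hβ _
        (FractionalIdeal.mem_coeIdeal_of_mem _ (Ideal.mem_map_of_mem (orderToRingOfIntegers R) hz'))
      obtain ⟨c, hc⟩ := (FractionalIdeal.mem_one_iff _).1 h1
      refine (FractionalIdeal.mem_one_iff _).2
        ⟨⟨_, coe_mem_order_of_mem_conductor (Ideal.mul_mem_left _ c hb)⟩, ?_⟩
      change algebraMap (𝓞 K) K (c * b) = β * algebraMap (𝓞 K) K b * (z : K)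
      rw [map_mul, hc, algebraMap_orderToRingOfIntegers]
      ring
    | zero =>
      intro β _
      rw [map_zero, zero_mul, zero_mul]
      exact Submodule.zero_mem _
    | add x y _ _ hx hy =>
      intro β hβ
      rw [map_add, add_mul, add_mul]
      exact Submodule.add_mem _ (hx β hβ) (hy β hβ)
    | smul c x _ hx =>
      intro β hβ
      -- `I·I⁻¹` is only an `𝔬`-module, so the scalar `c ∈ 𝓞 K` is absorbed into `β`.
      have := hx (c • β) (Submodule.smul_mem _ c hβ)
      rw [Algebra.smul_def] at this
      rw [smul_eq_mul, map_mul]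
      convert this using 1
      ring
  have key2 : ∀ y ∈ (E : FractionalIdeal (𝓞 K)⁰ K) * (E : FractionalIdeal (𝓞 K)⁰ K)⁻¹,
      y * algebraMap (𝓞 K) K b ∈
        (I : FractionalIdeal (order R)⁰ K) * (I : FractionalIdeal (order R)⁰ K)⁻¹ := by
    intro y hy
    refine FractionalIdeal.mul_induction_on hy ?_ ?_
    · intro i hi j hj
      obtain ⟨α, hα, rfl⟩ := (FractionalIdeal.mem_coeIdeal _).1 hi
      exact key α hα j hj
    · intro x y hx hy
      rw [add_mul]
      exact Submodule.add_mem _ hx hy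
  rw [mul_inv_cancel₀ hE0] at key2
  have h1 := key2 1 (FractionalIdeal.one_mem_one _)
  have h2 : (a : K) * 1 ∈
      (I : FractionalIdeal (order R)⁰ K) * (I : FractionalIdeal (order R)⁰ K)⁻¹ := by
    refine FractionalIdeal.mul_mem_mul (FractionalIdeal.mem_coeIdeal_of_mem _ ha) ?_
    rw [FractionalIdeal.mem_inv_iff hI0]
    intro y hy
    rw [one_mul]
    exact FractionalIdeal.coeIdeal_le_one hy
  have h3 := congrArg (algebraMap (𝓞 K) K) hab
  rw [map_add, map_one, algebraMap_orderToRingOfIntegers] at h3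
  rw [← h3]
  rw [one_mul] at h1
  rw [mul_one] at h2
  exact Submodule.add_mem _ h2 h1

theorem exists_inverted_smul_mem {R : Subring K} [IsFractionRing R K]
    (N : Submodule (order R) K) {x : K} (hx : x ∈ Submodule.span R (N : Set K)) :
    ∃ s ∈ inverted R, (s : K) * x ∈ N := by
  induction hx using Submodule.span_induction with
  | mem x hx => exact ⟨1, one_mem _, by simpa using hx⟩
  | zero => exact ⟨1, one_mem _, by simp⟩
  | add x y _ _ hx hy =>
    obtain ⟨s, hs, hsx⟩ := hx
    obtain ⟨t, ht, hty⟩ := hy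
    refine ⟨s * t, mul_mem hs ht, ?_⟩
    have : ((s * t : order R) : K) * (x + y) = t • ((s : K) * x) + s • ((t : K) * y) := by
      simp only [Subring.smul_def, smul_eq_mul, Subring.coe_mul]
      ring
    rw [this]
    exact add_mem (N.smul_mem _ hsx) (N.smul_mem _ hty)
  | smul r x _ hx =>
    obtain ⟨s, hs, hsx⟩ := hx
    obtain ⟨t, ht, c, hc⟩ := exists_inverted_mul_eq r.2
    refine ⟨t * s, mul_mem ht hs, ?_⟩
    have : ((t * s : order R) : K) * (r • x) = c • ((s : K) * x) := by
      simp only [Subring.smul_def, smul_eq_mul, Subring.coe_mul, ← hc]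
      ring
    rw [this]
    exact N.smul_mem _ hsx

theorem exists_inverted_smul_le_one {R : Subring K} [IsFractionRing R K]
    {N : Submodule (order R) K} (hN : N.FG) (hNR : ∀ x ∈ N, x ∈ R) :
    ∃ s ∈ inverted R, ∀ x ∈ N, (s : K) * x ∈ order R := by
  induction N, hN using Submodule.fg_induction with
  | singleton x =>
    obtain ⟨s, hs, y, hy⟩ := exists_inverted_mul_eq (hNR x (Submodule.mem_span_singleton_self x))
    refine ⟨s, hs, fun z hz => ?_⟩
    obtain ⟨c, rfl⟩ := Submodule.mem_span_singleton.1 hz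
    rw [mul_smul_comm, hy]
    exact (c * y).2
  | sup N₁ N₂ _ _ h₁ h₂ =>
    obtain ⟨s, hs, hs'⟩ := h₁ fun x hx => hNR x (Submodule.mem_sup_left hx)
    obtain ⟨t, ht, ht'⟩ := h₂ fun x hx => hNR x (Submodule.mem_sup_right hx)
    refine ⟨s * t, mul_mem hs ht, fun x hx => ?_⟩
    obtain ⟨y, hy, z, hz, rfl⟩ := Submodule.mem_sup.1 hx
    have : ((s * t : order R) : K) * (y + z) = (t : K) * ((s : K) * y) + s * ((t : K) * z) := by
      rw [Subring.coe_mul]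
      ring
    rw [this]
    exact add_mem (mul_mem t.2 (hs' y hy)) (mul_mem s.2 (ht' z hz))

end NumberRing

/-! ### Surjectivity and kernel of the extension map -/

namespace NumberRing

variable {K : Type*} [Field K] [NumberField K]

open FractionalIdeal

omit [NumberField K] in
instance (R : Subring K) : IsScalarTower (order R) R K :=
  ⟨fun x y z => mul_assoc (x : K) (y : K) z⟩

theorem coe_extendedHom {R : Subring K} [IsFractionRing R K] (I : FractionalIdeal (order R)⁰ K) :
    (extendedHom K R I : Submodule R K) = Submodule.span R (I : Set K) := by
  rw [extendedHom'_apply, coe_extended_eq_span]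
  congr 1
  -- Both rings have the same fraction field `K`, so the induced map on `K` is the identity.
  have hmap : IsLocalization.map K (algebraMap (order R) R)
      (nonZeroDivisors_le_comap_nonZeroDivisors_of_injective _
        (FaithfulSMul.algebraMap_injective (order R) R)) = RingHom.id K := by
    refine IsLocalization.ringHom_ext (order R)⁰ (RingHom.ext fun x => ?_)
    rw [RingHom.comp_apply, IsLocalization.map_eq]
    rfl
  rw [hmap]
  exact Set.image_id _

theorem extendedHom_le_iff {R : Subring K} [IsFractionRing R K]
    {I : FractionalIdeal (order R)⁰ K} {J : FractionalIdeal R⁰ K} :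
    extendedHom K R I ≤ J ↔ ∀ x ∈ I, x ∈ J := by
  rw [← coe_le_coe, coe_extendedHom, Submodule.span_le]
  rfl

theorem extendedHom_coeIdeal_eq_one {R : Subring K} [IsFractionRing R K] {I : Ideal (order R)}
    {s : order R} (hs : s ∈ inverted R) (hsI : s ∈ I) :
    extendedHom K R (I : FractionalIdeal (order R)⁰ K) = 1 := by
  rw [extendedHom_coeIdeal_eq_map, Ideal.eq_top_of_isUnit_mem _ (Ideal.mem_map_of_mem _ hsI) hs,
    coeIdeal_top]

/-- One element of `S` clears the denominators of all generators of `I`; another brings `1 ∈ IR`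
into `I`. Finite generation replaces invertibility so that the lemma can be used to prove
invertibility. -/
theorem exists_inverted_mem_coeIdeal {R : Subring K} [IsFractionRing R K]
    {I : FractionalIdeal (order R)⁰ K} (hfg : (I : Submodule (order R) K).FG)
    (hI : extendedHom K R I = 1) :
    ∃ t ∈ inverted R, ∃ 𝔞 : Ideal (order R), (𝔞 : FractionalIdeal (order R)⁰ K) =
      spanSingleton (order R)⁰ (t : K) * I ∧ ∃ s ∈ inverted R, s ∈ 𝔞 := by
  have h1 : ∀ x ∈ (I : Submodule (order R) K), x ∈ R := fun x hx => by
    obtain ⟨y, rfl⟩ := (mem_one_iff _).1 (extendedHom_le_iff.1 hI.le x hx)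
    exact y.2
  obtain ⟨t, ht, h⟩ := exists_inverted_smul_le_one hfg h1
  have h2 : (1 : K) ∈ Submodule.span R (I : Set K) := by
    rw [← coe_extendedHom, hI]
    exact one_mem_one _
  obtain ⟨s, hs, hsI⟩ := exists_inverted_smul_mem (I : Submodule (order R) K) h2
  rw [mul_one] at hsI
  have hle : spanSingleton (order R)⁰ (t : K) * I ≤ 1 := by
    rw [spanSingleton_mul_le_iff]
    exact fun z hz => (mem_one_iff _).2 ⟨⟨_, h z hz⟩, rfl⟩
  obtain ⟨𝔞, h𝔞⟩ := le_one_iff_exists_coeIdeal.1 hle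
  refine ⟨t, ht, 𝔞, h𝔞, t * s, mul_mem ht hs, ?_⟩
  have : algebraMap (order R) K (t * s) ∈ (𝔞 : FractionalIdeal (order R)⁰ K) := by
    rw [h𝔞, map_mul]
    exact mul_mem_mul (mem_spanSingleton_self _ _) hsI
  obtain ⟨z, hz, hzeq⟩ := (mem_coeIdeal _).1 this
  rwa [← IsFractionRing.injective (order R) K hzeq]

theorem extendedHom_spanSingleton_eq {R : Subring K} [IsFractionRing R K] (x : K) :
    extendedHom K R (spanSingleton (order R)⁰ x) = spanSingleton R⁰ x := by
  rw [← coeToSubmodule_inj, coe_extendedHom, coe_spanSingleton]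
  have : (spanSingleton (order R)⁰ x : Set K) =
      ((Submodule.span (order R) {x} : Submodule (order R) K) : Set K) := by
    rw [← coe_spanSingleton (order R)⁰]
    rfl
  rw [this, Submodule.span_span_of_tower]

/-- Finite sets in `J` and `J⁻¹` suffice to express `1 ∈ J·J⁻¹`. Let `A`, `B` be their `𝔬`-spans.
Then `AB` extends to `R`, so a multiple of it is an ideal meeting `S`; thus `AB`, and with it `A`,
is invertible. -/
theorem exists_extendedHom_eq {R : Subring K} [IsFractionRing R K] (J : (FractionalIdeal R⁰ K)ˣ) :
    ∃ I : (FractionalIdeal (order R)⁰ K)ˣ, extendedHom K R (I : FractionalIdeal (order R)⁰ K) =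
      J := by
  have hone : (1 : K) ∈ (J : FractionalIdeal R⁰ K) * (J⁻¹ : (FractionalIdeal R⁰ K)ˣ) := by
    rw [Units.mul_inv]
    exact one_mem_one _
  obtain ⟨T, T', hT, hT', h1⟩ := mem_span_mul_finite_of_mem_mul hone
  have span_le : ∀ (U : Finset K) (L : FractionalIdeal R⁰ K), (U : Set K) ⊆ L →
      extendedHom K R (spanFinset (order R) U id) ≤ L := by
    intro U L hU
    rw [extendedHom_le_iff]
    have : Submodule.span (order R) (id '' (U : Set K)) ≤
        (L : Submodule R K).restrictScalars (order R) := by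
      rw [Set.image_id, Submodule.span_le]
      exact hU
    exact this
  have hA := span_le T _ hT
  have hB := span_le T' _ hT'
  set A := spanFinset (order R) T id
  set B := spanFinset (order R) T' id
  have hAB : extendedHom K R (A * B) = 1 := by
    refine le_antisymm ?_ ?_
    · rw [map_mul, ← Units.mul_inv J]
      exact mul_le_mul' hA hB
    · rw [FractionalIdeal.one_le, ← mem_coe, coe_extendedHom]
      refine Submodule.span_mono ?_ h1
      rintro _ ⟨a, ha, b, hb, rfl⟩
      exact mul_mem_mul (Submodule.subset_span ⟨a, ha, rfl⟩) (Submodule.subset_span ⟨b, hb, rfl⟩)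
  have hfg : ((A * B : FractionalIdeal (order R)⁰ K) : Submodule (order R) K).FG := by
    rw [coe_mul]
    exact (Submodule.fg_span (T.finite_toSet.image _)).mul
      (Submodule.fg_span (T'.finite_toSet.image _))
  obtain ⟨t, -, 𝔞, h𝔞, s, hs, hs𝔞⟩ := exists_inverted_mem_coeIdeal hfg hAB
  have hu := isUnit_coeIdeal_of_mem_inverted hs hs𝔞
  rw [h𝔞, mul_left_comm] at hu
  refine ⟨(isUnit_of_mul_isUnit_left hu).unit, le_antisymm hA ?_⟩
  calc (J : FractionalIdeal R⁰ K) = J * (extendedHom K R A * extendedHom K R B) := by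
        rw [← map_mul, hAB, mul_one]
    _ ≤ J * (extendedHom K R A * (J⁻¹ : (FractionalIdeal R⁰ K)ˣ)) := by gcongr
    _ = extendedHom K R A := by rw [mul_left_comm, Units.mul_inv, mul_one]

theorem extendedHom_surjective (R : Subring K) [IsFractionRing R K] :
    Function.Surjective (ClassGroup.extendedHom (order R) R) := by
  intro x
  obtain ⟨J, rfl⟩ : ∃ J, ClassGroup.mk K J = x := ClassGroup.induction K (fun J => ⟨J, rfl⟩) x
  obtain ⟨I, hI⟩ := exists_extendedHom_eq J
  refine ⟨ClassGroup.mk K I, ?_⟩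
  rw [ClassGroup.extendedHom_mk_of_isFractionRing _ _ K K]
  exact congrArg _ (Units.ext hI)

theorem extendedHom_mk_eq_one {R : Subring K} [IsFractionRing R K] {I : Ideal (order R)}
    {s : order R} (hs : s ∈ inverted R) (hsI : s ∈ I) {J : (FractionalIdeal (order R)⁰ K)ˣ}
    (hJ : (J : FractionalIdeal (order R)⁰ K) = I) :
    ClassGroup.extendedHom (order R) R (ClassGroup.mk K J) = 1 := by
  rw [ClassGroup.extendedHom_mk_of_isFractionRing _ _ K K,
    show Units.map (extendedHom K R).toMonoidHom J = 1 from
      Units.ext (by simpa [hJ] using extendedHom_coeIdeal_eq_one hs hsI), map_one]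

theorem exists_ideal_of_extendedHom_mk_eq_one {R : Subring K} [IsFractionRing R K]
    {I : (FractionalIdeal (order R)⁰ K)ˣ}
    (hI : ClassGroup.extendedHom (order R) R (ClassGroup.mk K I) = 1) :
    ∃ (J : (FractionalIdeal (order R)⁰ K)ˣ) (𝔞 : Ideal (order R)),
      (J : FractionalIdeal (order R)⁰ K) = 𝔞 ∧ ClassGroup.mk K J = ClassGroup.mk K I ∧
        ∃ s ∈ inverted R, s ∈ 𝔞 := by
  rw [ClassGroup.extendedHom_mk_of_isFractionRing _ _ K K, ClassGroup.mk_eq_one_iff] at hI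
  have mk_principal : ∀ y : Kˣ, ClassGroup.mk K (toPrincipalIdeal (order R) K y) = 1 := by
    intro y
    rw [ClassGroup.mk_eq_one_iff, coe_toPrincipalIdeal, coe_spanSingleton]
    exact ⟨⟨_, rfl⟩⟩
  obtain ⟨x, hx⟩ := hI.principal
  have hx' : extendedHom K R (I : FractionalIdeal (order R)⁰ K) = spanSingleton R⁰ x := by
    rw [← coeToSubmodule_inj, coe_spanSingleton, ← hx]
    rfl
  have hx0 : x ≠ 0 := by
    rintro rfl
    rw [spanSingleton_zero] at hx'
    exact (Units.map (extendedHom K R).toMonoidHom I).ne_zero hx'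
  -- Dividing by a generator `x` of the extended ideal keeps the class and makes the extension
  -- exactly `R`.
  have h1 : extendedHom K R
      ((toPrincipalIdeal (order R) K (Units.mk0 x hx0)⁻¹ * I : (FractionalIdeal (order R)⁰ K)ˣ) :
        FractionalIdeal (order R)⁰ K) = 1 := by
    rw [Units.val_mul, map_mul, hx', coe_toPrincipalIdeal, extendedHom_spanSingleton_eq,
      spanSingleton_mul_spanSingleton, Units.val_inv_eq_inv_val, Units.val_mk0,
      inv_mul_cancel₀ hx0, spanSingleton_one]
  obtain ⟨t, ht, 𝔞, h𝔞, hs⟩ := exists_inverted_mem_coeIdeal (fg_unit _) h1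
  refine ⟨toPrincipalIdeal (order R) K (Units.mk0 (t : K) (mem_inverted_iff.1 ht).1) *
    (toPrincipalIdeal (order R) K (Units.mk0 x hx0)⁻¹ * I), 𝔞, ?_, ?_, hs⟩
  · rw [h𝔞, Units.val_mul, coe_toPrincipalIdeal, Units.val_mk0]
  · rw [map_mul, map_mul, mk_principal, mk_principal, one_mul, one_mul]

-- Lying over for the integral extension `𝔬 ⊆ 𝓞 K`; the nonzero `s` keeps the prime above from being
-- zero.
omit [NumberField K] in
theorem exists_heightOneSpectrum_contraction_eq (R : Subring K) {𝔪 : Ideal (order R)}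
    (h𝔪 : 𝔪.IsMaximal) {s : order R} (hs0 : s ≠ 0) (hs : s ∈ 𝔪) :
    ∃ p : HeightOneSpectrum (𝓞 K), contraction R p = 𝔪 := by
  let _ := (orderToRingOfIntegers R).toAlgebra
  have hinj : Function.Injective (algebraMap (order R) (𝓞 K)) :=
    fun x y h => Subtype.ext (congrArg (algebraMap (𝓞 K) K) h)
  have : Algebra.IsIntegral (order R) (𝓞 K) := Algebra.IsIntegral.tower_top ℤ
  obtain ⟨Q, hQ, hQ𝔪⟩ := Ideal.exists_ideal_over_maximal_of_isIntegral (S := 𝓞 K) 𝔪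
    (by rw [(RingHom.injective_iff_ker_eq_bot _).1 hinj]; exact bot_le)
  refine ⟨⟨Q, hQ.isPrime, ?_⟩, hQ𝔪⟩
  rintro rfl
  rw [← hQ𝔪, Ideal.mem_comap, Ideal.mem_bot] at hs
  exact hs0 (hinj (hs.trans (map_zero _).symm))

/-- Noetherian induction: a maximal ideal over `𝔞` also contains `s`, so it is invertible and is the
contraction of a prime in `T`. Dividing by it gives a strictly larger ideal still containing `s`. -/
theorem mk_mem_of_forall_contraction {R : Subring K} [IsFractionRing R K]
    {H : Subgroup (ClassGroup (order R))}
    (hH : ∀ p ∈ polePrimes R, ∀ J : (FractionalIdeal (order R)⁰ K)ˣ,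
      (J : FractionalIdeal (order R)⁰ K) = contraction R p → ClassGroup.mk K J ∈ H)
    {s : order R} (hs : s ∈ inverted R) (𝔞 : Ideal (order R)) (hs𝔞 : s ∈ 𝔞)
    (J : (FractionalIdeal (order R)⁰ K)ˣ) (hJ : (J : FractionalIdeal (order R)⁰ K) = 𝔞) :
    ClassGroup.mk K J ∈ H := by
  induction 𝔞 using IsNoetherian.induction generalizing J with
  | hgt 𝔞 ih =>
    by_cases htop : 𝔞 = ⊤
    · rw [htop, coeIdeal_top, Units.val_eq_one] at hJ
      rw [hJ, map_one]
      exact H.one_mem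
    obtain ⟨𝔪, h𝔪, hle⟩ := Ideal.exists_le_maximal 𝔞 htop
    have hs0 : s ≠ 0 := fun h => (mem_inverted_iff.1 hs).1 (by rw [h]; rfl)
    obtain ⟨p, rfl⟩ := exists_heightOneSpectrum_contraction_eq R h𝔪 hs0 (hle hs𝔞)
    obtain ⟨M, hM⟩ := isUnit_coeIdeal_of_mem_inverted hs (hle hs𝔞)
    have hJM : (J : FractionalIdeal (order R)⁰ K) ≤ M := by
      rw [hJ, hM]
      exact (coeIdeal_le_coeIdeal K).2 hle
    have hle1 : ((J * M⁻¹ : (FractionalIdeal (order R)⁰ K)ˣ) :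
        FractionalIdeal (order R)⁰ K) ≤ 1 := by
      rw [Units.val_mul, ← Units.mul_inv M]
      gcongr
    obtain ⟨𝔟, h𝔟⟩ := le_one_iff_exists_coeIdeal.1 hle1
    have h𝔞𝔟 : 𝔞 = 𝔟 * contraction R p := by
      rw [← coeIdeal_inj (K := K), coeIdeal_mul, h𝔟, ← hM, ← hJ, Units.val_mul,
        Units.inv_mul_cancel_right]
    have hlt : 𝔞 < 𝔟 := by
      refine lt_of_le_of_ne (h𝔞𝔟 ▸ Ideal.mul_le_left) ?_
      rintro rfl
      -- Equality would give `J·M⁻¹ = J`, hence `M = 1`, contradicting maximality.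
      rw [← hJ, Units.val_inj, eq_comm, mul_eq_left, inv_eq_one] at h𝔟
      rw [h𝔟, Units.val_one, ← coeIdeal_top, coeIdeal_inj] at hM
      exact h𝔪.ne_top hM.symm
    rw [← inv_mul_cancel_right J M, map_mul]
    exact H.mul_mem (ih 𝔟 hlt (hlt.le hs𝔞) _ h𝔟.symm)
      (hH p (mem_polePrimes_of_mem_contraction hs (hle hs𝔞)) M hM)

end NumberRing

/-! ### The homomorphism out of the group generated by `T` -/

namespace FractionalIdeal

variable {A K G : Type*} [CommRing A] [IsDedekindDomain A] [Field K] [Algebra A K]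
  [IsFractionRing A K] [CommGroup G]

/-- The homomorphism `I ↦ ∏ g(v) ^ ord_v(I)`, the product being over `v ∈ s`. -/
noncomputable def prodZPowCount (s : Finset (HeightOneSpectrum A)) (g : HeightOneSpectrum A → G) :
    (FractionalIdeal A⁰ K)ˣ →* G where
  toFun I := ∏ v ∈ s, g v ^ count K v (I : FractionalIdeal A⁰ K)
  map_one' := Finset.prod_eq_one fun v _ => by rw [Units.val_one, count_one, zpow_zero]
  map_mul' I J := by
    rw [← Finset.prod_mul_distrib]
    exact Finset.prod_congr rfl fun v _ => by
      rw [Units.val_mul, count_mul K v I.ne_zero J.ne_zero, zpow_add]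

theorem prodZPowCount_apply (s : Finset (HeightOneSpectrum A)) (g : HeightOneSpectrum A → G)
    (I : (FractionalIdeal A⁰ K)ˣ) :
    prodZPowCount s g I = ∏ v ∈ s, g v ^ count K v (I : FractionalIdeal A⁰ K) := rfl

theorem prodZPowCount_eq_of_coe_eq {s : Finset (HeightOneSpectrum A)} (g : HeightOneSpectrum A → G)
    {v : HeightOneSpectrum A} (hv : v ∈ s) {I : (FractionalIdeal A⁰ K)ˣ}
    (hI : (I : FractionalIdeal A⁰ K) = v.asIdeal) : prodZPowCount s g I = g v := by
  rw [prodZPowCount_apply, hI, Finset.prod_eq_single v, count_self, zpow_one]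
  · intro w _ hw
    rw [count_maximal_coprime K w hw.symm, zpow_zero]
  · exact fun h => absurd hv h

end FractionalIdeal

theorem mainTheorem8 {K : Type*} [Field K] [NumberField K]
    (R : Subring K) [IsFractionRing R K] (hT : (NumberRing.polePrimes R).Finite) :
    ∃ c : NumberRing.poleGroup R →* ClassGroup (NumberRing.order R),
      (∀ p : NumberRing.polePrimes R,
        ∃ J : (FractionalIdeal (NumberRing.order R)⁰ K)ˣ,
          (J : FractionalIdeal (NumberRing.order R)⁰ K) =
            (NumberRing.contraction R p.1 : FractionalIdeal (NumberRing.order R)⁰ K) ∧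
          c (NumberRing.polePrime R p) = ClassGroup.mk K J) ∧
      c.range = (ClassGroup.extendedHom (NumberRing.order R) R).ker ∧
      Function.Surjective (ClassGroup.extendedHom (NumberRing.order R) R) := by
  have hu : ∀ p : HeightOneSpectrum (𝓞 K), p ∈ NumberRing.polePrimes R →
      IsUnit (NumberRing.contraction R p : FractionalIdeal (NumberRing.order R)⁰ K) := by
    intro p hp
    obtain ⟨s, hs, hsp⟩ := NumberRing.exists_mem_inverted_mem_contraction hp
    exact NumberRing.isUnit_coeIdeal_of_mem_inverted hs hsp
  choose! M hM using hu
  let g : HeightOneSpectrum (𝓞 K) → ClassGroup (NumberRing.order R) := fun p =>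
    ClassGroup.mk K (M p)
  -- Prescribing values through the exponents `ord_𝔭` makes `c` well defined; finiteness of `T`
  -- makes the product finite.
  let c : NumberRing.poleGroup R →* ClassGroup (NumberRing.order R) :=
    (FractionalIdeal.prodZPowCount hT.toFinset g).comp (NumberRing.poleGroup R).subtype
  have hc : ∀ p : NumberRing.polePrimes R, c (NumberRing.polePrime R p) = g p.1 := fun p =>
    FractionalIdeal.prodZPowCount_eq_of_coe_eq g (hT.mem_toFinset.2 p.2) rfl
  refine ⟨c, fun p => ⟨M p.1, hM p.1 p.2, hc p⟩, le_antisymm ?_ ?_,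
    NumberRing.extendedHom_surjective R⟩
  · rintro _ ⟨B, rfl⟩
    refine Subgroup.prod_mem _ fun p hp => Subgroup.zpow_mem _ ?_ _
    have hp' := hT.mem_toFinset.1 hp
    obtain ⟨s, hs, hsp⟩ := NumberRing.exists_mem_inverted_mem_contraction hp'
    exact NumberRing.extendedHom_mk_eq_one hs hsp (hM p hp')
  · intro x hx
    obtain ⟨I, rfl⟩ : ∃ I, ClassGroup.mk K I = x := ClassGroup.induction K (fun I => ⟨I, rfl⟩) x
    obtain ⟨J, 𝔞, hJ, hJI, s, hs, hs𝔞⟩ := NumberRing.exists_ideal_of_extendedHom_mk_eq_one hx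
    rw [← hJI]
    refine NumberRing.mk_mem_of_forall_contraction ?_ hs 𝔞 hs𝔞 J hJ
    intro p hp L hL
    exact ⟨NumberRing.polePrime R ⟨p, hp⟩,
      (hc ⟨p, hp⟩).trans (congrArg (ClassGroup.mk K) (Units.ext ((hM p hp).trans hL.symm)))⟩
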